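/- Let $d \ge 0$ be an integer, let $A \subset \mathbb{Z}^d$ be a finite set, and let $Q = [0,1)^d \subset \mathbb{R}^d$. For $G = \mathbb{Z}^d$ with counting measure or $G = \mathbb{R}^d$ with Lebesgue measure, a subset $\Omega \subseteq G$ of finite measure is called *spectral in $G$* if there is a set $\Lambda$ of continuous characters of $G$ (continuous homomorphisms from $G$ to the circle group $\{z \in \mathbb{C} : |z| = 1\}$) whose restrictions to $\Omega$ form an orthogonal basis of the complex Hilbert space $L^2(\Omega)$: the restrictions are nonzero in $L^2(\Omega)$, those of distinct elements of $\Lambda$ are orthogonal, and their linear span is dense in $L^2(\Omega)$. Then $A$ is spectral in $\mathbb{Z}^d$ if and only if $A + Q = \{a + q : a \in A,\ q \in Q\}$ is spectral in $\mathbb{R}^d$. -/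

import Mathlib

open MeasureTheory
open scoped Pointwise

/-- `Λ` is a spectrum of the set `Ω` in the abelian group `G` with Haar measure `μ`: it is a set of
continuous characters of `G` whose restrictions to `Ω` form an orthogonal basis of the Hilbert space
`L²(Ω)`, that is, they are nonzero, pairwise orthogonal, and have dense linear span. Here `v χ` is
the class of the character `χ` in `L²(Ω)`. -/
def IsSpectrum {G : Type*} [AddCommGroup G] [TopologicalSpace G] [MeasurableSpace G]
    (μ : Measure G) (Ω : Set G) (Λ : Set (AddChar G Circle)) : Prop :=
  (∀ χ ∈ Λ, Continuous χ) ∧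
  ∃ v : Λ → Lp ℂ 2 (μ.restrict Ω),
    (∀ χ : Λ, v χ =ᵐ[μ.restrict Ω] fun x => ((χ : AddChar G Circle) x : ℂ)) ∧
    (∀ χ : Λ, v χ ≠ 0) ∧
    (∀ χ ψ : Λ, χ ≠ ψ → inner ℂ (v χ) (v ψ) = 0) ∧
    (Submodule.span ℂ (Set.range v)).topologicalClosure = ⊤

/-- `Ω` is spectral in `G` (with Haar measure `μ`) if it has a spectrum. -/
def IsSpectral {G : Type*} [AddCommGroup G] [TopologicalSpace G] [MeasurableSpace G]
    (μ : Measure G) (Ω : Set G) : Prop :=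
  ∃ Λ : Set (AddChar G Circle), IsSpectrum μ Ω Λ

/-- The half-open unit cube `[0,1)^d` in `ℝ^d`. -/
def unitCube (d : ℕ) : Set (Fin d → ℝ) :=
  Set.univ.pi fun _ => Set.Ico 0 1

/-- A subset of `ℤ^d`, regarded as a subset of `ℝ^d`. -/
def latticeToReal (d : ℕ) (A : Set (Fin d → ℤ)) : Set (Fin d → ℝ) :=
  (fun (a : Fin d → ℤ) (i : Fin d) => (a i : ℝ)) '' A

/-!
The equivalence rests on the Fourier transform of the unit cube `Q`: it vanishes exactly at the
points with a nonzero integer coordinate, and the character sum of `A` times this transform gives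
the inner products of exponentials over `A + Q`.

If `A` has a spectrum, let `Θ` be the set of all its frequencies in `ℝ^d`, which is invariant under
`ℤ^d`. Writing the points of `A + Q` as `a + x`, the frequencies in one class of `Θ` modulo `ℤ^d`
form a Fourier basis in `x`, and the classes correspond to the given spectrum in `a`.

Conversely, let `Ξ` be the frequencies of a spectrum of `A + Q`. Parseval's identity for an
exponential `η` cut off to a single cube gives `∑ ξ ∈ Ξ, |Q̂ (η - ξ)|² = |A|` for every `η`. Since
`∫ |Q̂|² = 1`, averaging over `η ∈ Q` yields a translate of `Q` containing at least `|A|` points of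
`Ξ`. Their differences lie in `(-1,1)^d`, where `Q̂` has no zeros, so orthogonality over `A + Q`
forces orthogonality over `A`, and `|A|` orthogonal characters form a basis of `L²(A)`.
-/

open scoped ComplexConjugate

/-! ### Characters of `ℝ^ι` and `ℤ^ι` -/

section Characters

variable {ι : Type*}

/-- The inclusion of the lattice `ℤ^ι` into `ℝ^ι`; `latticeToReal d A` is the image of `A` under it,
for `ι = Fin d`. -/
def intVec : (ι → ℤ) →+ (ι → ℝ) :=
  (Int.castAddHom ℝ).compLeft ι

lemma intVec_apply (n : ι → ℤ) (i : ι) : intVec n i = n i := rfl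

lemma addChar_map_sum {κ M N : Type*} [AddCommMonoid M] [CommMonoid N] (ψ : AddChar M N)
    (s : Finset κ) (f : κ → M) : ψ (∑ i ∈ s, f i) = ∏ i ∈ s, ψ (f i) :=
  map_prod ψ.toMonoidHom (fun i => Multiplicative.ofAdd (f i)) s

lemma fourierChar_eq_one_iff (x : ℝ) : Real.fourierChar x = 1 ↔ ∃ n : ℤ, x = n := by
  rw [Real.fourierChar_apply', Circle.exp_eq_one]
  refine exists_congr fun n => ?_
  rw [mul_comm, mul_left_inj' Real.two_pi_pos.ne']

lemma conj_circle_mul_self (z : Circle) : conj (z : ℂ) * z = 1 := by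
  rw [← Circle.coe_inv_eq_conj, ← Circle.coe_mul, inv_mul_cancel, Circle.coe_one]

/-- `L` is the continuous lift of `χ` through the covering `Circle.exp` that vanishes at `0`. -/
lemma exists_eq_circleExp_comp {E : Type*} [NormedAddCommGroup E] [NormedSpace ℝ E]
    (χ : AddChar E Circle) (hχ : Continuous χ) : ∃ L : E →L[ℝ] ℝ, ∀ x, χ x = Circle.exp (L x) := by
  obtain ⟨F, ⟨hF0, hF⟩, -⟩ := Circle.isCoveringMap_exp.existsUnique_continuousMap_lifts
    ⟨χ, hχ⟩ 0 0 (by simp)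
  have exp_F (x : E) : Circle.exp (F x) = χ x := congrFun hF x
  have F_add (x y : E) : F (x + y) = F x + F y := by
    have h : (fun p : E × E => F (p.1 + p.2)) = fun p => F p.1 + F p.2 := by
      refine Circle.isCoveringMap_exp.eq_of_comp_eq (by fun_prop) (by fun_prop) ?_ (0, 0)
        (by simp [hF0])
      ext1 p
      simp only [Function.comp_apply, Circle.exp_add, exp_F, AddChar.map_add_eq_mul]
    exact congrFun h (x, y)
  exact ⟨AddMonoidHom.toRealLinearMap ⟨⟨F, hF0⟩, F_add⟩ F.continuous, fun x => (exp_F x).symm⟩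

variable [Fintype ι]

/-- The character `x ↦ exp (2πi t·x)` of `ℝ^ι`. -/
noncomputable def expChar (t : ι → ℝ) : AddChar (ι → ℝ) Circle where
  toFun x := Real.fourierChar (t ⬝ᵥ x)
  map_zero_eq_one' := by simp
  map_add_eq_mul' x y := by rw [dotProduct_add, AddChar.map_add_eq_mul]

/-- The character `n ↦ exp (2πi t·n)` of `ℤ^ι`. -/
noncomputable def latticeChar (t : ι → ℝ) : AddChar (ι → ℤ) Circle :=
  (expChar t).compAddMonoidHom intVec

lemma expChar_apply (t x : ι → ℝ) : expChar t x = Real.fourierChar (t ⬝ᵥ x) := rfl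

lemma expChar_intVec (t : ι → ℝ) (n : ι → ℤ) : expChar t (intVec n) = latticeChar t n := rfl

lemma coe_expChar_eq_prod (t x : ι → ℝ) :
    (expChar t x : ℂ) = ∏ i, (Real.fourierChar (t i * x i) : ℂ) := by
  rw [expChar_apply, dotProduct, addChar_map_sum]
  exact map_prod Circle.coeHom _ _

lemma latticeChar_apply_single [DecidableEq ι] (t : ι → ℝ) (i : ι) :
    latticeChar t (Pi.single i 1) = Real.fourierChar (t i) := by
  have h : intVec (Pi.single i 1) = Pi.single i 1 := by
    ext j
    simp [intVec_apply, Pi.single_apply]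
  rw [← expChar_intVec, expChar_apply, h, dotProduct_single_one]

lemma continuous_expChar_apply : Continuous fun p : (ι → ℝ) × (ι → ℝ) => expChar p.1 p.2 := by
  simp only [expChar_apply, dotProduct]
  fun_prop

lemma continuous_expChar (t : ι → ℝ) : Continuous (expChar t) :=
  continuous_expChar_apply.comp (.prodMk_right t)

lemma expChar_add_apply (s t x : ι → ℝ) : expChar (s + t) x = expChar s x * expChar t x := by
  rw [expChar_apply, add_dotProduct, AddChar.map_add_eq_mul, expChar_apply, expChar_apply]

lemma conj_expChar_mul_expChar (s t x : ι → ℝ) :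
    conj (expChar s x : ℂ) * expChar t x = expChar (t - s) x := by
  have h : expChar t x = expChar s x * expChar (t - s) x := by
    rw [← expChar_add_apply, add_sub_cancel]
  rw [h, Circle.coe_mul, ← mul_assoc, conj_circle_mul_self, one_mul]

lemma latticeChar_add_intVec (t : ι → ℝ) (m : ι → ℤ) :
    latticeChar (t + intVec m) = latticeChar t := by
  ext1 n
  have h : intVec m ⬝ᵥ intVec n = ((m ⬝ᵥ n : ℤ) : ℝ) := by simp [dotProduct, intVec_apply]
  rw [← expChar_intVec, expChar_add_apply, expChar_apply (intVec m), h,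
    (fourierChar_eq_one_iff _).mpr ⟨_, rfl⟩, mul_one, expChar_intVec]

lemma exists_eq_add_intVec_of_latticeChar_eq {s t : ι → ℝ} (h : latticeChar s = latticeChar t) :
    ∃ n, t = s + intVec n := by
  classical
  have hint (i : ι) : ∃ n : ℤ, t i - s i = n := by
    rw [← fourierChar_eq_one_iff, AddChar.map_sub_eq_div, ← latticeChar_apply_single,
      ← latticeChar_apply_single, h, div_self']
  choose n hn using hint
  exact ⟨n, funext fun i => (eq_add_of_sub_eq' (hn i))⟩

lemma exists_eq_expChar (χ : AddChar (ι → ℝ) Circle) (hχ : Continuous χ) : ∃ t, χ = expChar t := by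
  classical
  obtain ⟨L, hL⟩ := exists_eq_circleExp_comp χ hχ
  refine ⟨fun i => L (Pi.single i 1) / (2 * Real.pi), ?_⟩
  ext1 x
  have hx : L x = ∑ i, x i * L (Pi.single i 1) := by
    conv_lhs => rw [pi_eq_sum_univ' x]
    simp only [map_sum, map_smul, smul_eq_mul]
  rw [hL, hx, expChar_apply, Real.fourierChar_apply', dotProduct, Finset.mul_sum]
  refine congrArg Circle.exp (Finset.sum_congr rfl fun i _ => ?_)
  field_simp

lemma exists_eq_latticeChar (χ : AddChar (ι → ℤ) Circle) : ∃ t, χ = latticeChar t := by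
  classical
  have surj (z : Circle) : ∃ s : ℝ, Real.fourierChar s = z := by
    obtain ⟨s, rfl⟩ := Circle.exp_surjective z
    exact ⟨s / (2 * Real.pi), by
      rw [Real.fourierChar_apply', mul_div_cancel₀ _ Real.two_pi_pos.ne']⟩
  choose t ht using fun i => surj (χ (Pi.single i 1))
  refine ⟨t, ?_⟩
  ext1 n
  rw [pi_eq_sum_univ' n, addChar_map_sum, addChar_map_sum]
  refine Finset.prod_congr rfl fun i _ => ?_
  rw [AddChar.map_zsmul_eq_zpow, AddChar.map_zsmul_eq_zpow, latticeChar_apply_single, ht]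

end Characters

section OrthogonalFamilies

variable {𝕜 E ι : Type*} [RCLike 𝕜] [NormedAddCommGroup E] [InnerProductSpace 𝕜 E] {v : ι → E}

lemma eq_zero_of_forall_inner_eq_zero (hv : Dense (Submodule.span 𝕜 (Set.range v) : Set E)) {x : E}
    (hx : ∀ i, inner 𝕜 (v i) x = 0) : x = 0 := by
  have h : innerSL 𝕜 x = 0 := ContinuousLinearMap.ext_on hv <| Set.forall_mem_range.mpr fun i =>
    inner_eq_zero_symm.mp (hx i)
  simpa using DFunLike.congr_fun h x

lemma orthonormal_normalize (hv : ∀ i, v i ≠ 0)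
    (ho : Pairwise fun i j => inner 𝕜 (v i) (v j) = 0) :
    Orthonormal 𝕜 fun i => (‖v i‖ : 𝕜)⁻¹ • v i := by
  refine ⟨fun i => ?_, fun i j hij => ?_⟩
  · exact norm_smul_inv_norm (hv i)
  · simp only [inner_smul_left, inner_smul_right, ho hij, mul_zero]

lemma countable_of_pairwise_inner_eq_zero [TopologicalSpace.SeparableSpace E]
    (hv : ∀ i, v i ≠ 0) (ho : Pairwise fun i j => inner 𝕜 (v i) (v j) = 0) : Countable ι := by
  have hon := orthonormal_normalize hv ho
  set u := fun i => (‖v i‖ : 𝕜)⁻¹ • v i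
  have hdist {i j : ι} (hij : i ≠ j) : 1 < dist (u i) (u j) := by
    have h : dist (u i) (u j) ^ 2 = 2 := by
      rw [dist_eq_norm, @norm_sub_sq 𝕜, hon.1, hon.1, hon.2 hij, map_zero]
      norm_num
    nlinarith [dist_nonneg (x := u i) (y := u j)]
  rw [← Set.countable_univ_iff]
  refine Set.PairwiseDisjoint.countable_of_isOpen (s := fun i => Metric.ball (u i) (1 / 2))
    (fun i _ j _ hij => Metric.ball_disjoint_ball ?_) (fun i _ => Metric.isOpen_ball)
    fun i _ => ⟨u i, Metric.mem_ball_self (by norm_num)⟩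
  rw [add_halves]
  exact (hdist hij).le

lemma hasSum_norm_inner_sq_div_norm_sq [CompleteSpace E] (hv : ∀ i, v i ≠ 0)
    (ho : Pairwise fun i j => inner 𝕜 (v i) (v j) = 0)
    (hd : (Submodule.span 𝕜 (Set.range v)).topologicalClosure = ⊤) (x : E) :
    HasSum (fun i => ‖inner 𝕜 (v i) x‖ ^ 2 / ‖v i‖ ^ 2) (‖x‖ ^ 2) := by
  have hspan : Submodule.span 𝕜 (Set.range v) ≤
      Submodule.span 𝕜 (Set.range fun i => (‖v i‖ : 𝕜)⁻¹ • v i) := by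
    rw [Submodule.span_le, Set.range_subset_iff]
    intro i
    have h : (‖v i‖ : 𝕜) • (‖v i‖ : 𝕜)⁻¹ • v i = v i := by
      rw [smul_inv_smul₀ (by simpa using hv i)]
    rw [← h]
    exact Submodule.smul_mem _ _ (Submodule.subset_span ⟨i, rfl⟩)
  let b := HilbertBasis.mk (orthonormal_normalize hv ho)
    (hd.ge.trans (Submodule.topologicalClosure_mono hspan))
  have hb (i : ι) : b i = (‖v i‖ : 𝕜)⁻¹ • v i := by simp only [b, HilbertBasis.coe_mk]
  convert RCLike.hasSum_re 𝕜 (b.hasSum_inner_mul_inner x x) using 1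
  · ext i
    rw [← inner_conj_symm x, RCLike.conj_mul, ← RCLike.ofReal_pow, RCLike.ofReal_re, hb,
      inner_smul_left, norm_mul, RCLike.norm_conj, norm_inv, RCLike.norm_ofReal, abs_norm, mul_pow,
      inv_pow, div_eq_inv_mul]
  · exact (inner_self_eq_norm_sq x).symm

end OrthogonalFamilies

/-! ### Fourier coefficients and spectra -/

lemma inner_eq_integral_of_ae_eq {α : Type*} [MeasurableSpace α] {ν : Measure α}
    {u v : Lp ℂ 2 ν} {f g : α → ℂ} (hu : u =ᵐ[ν] f) (hv : v =ᵐ[ν] g) :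
    inner ℂ u v = ∫ x, conj (f x) * g x ∂ν := by
  rw [L2.inner_def]
  refine integral_congr_ae ?_
  filter_upwards [hu, hv] with x hx hy
  rw [hx, hy, RCLike.inner_apply']

lemma norm_sq_eq_integral_of_ae_eq {α : Type*} [MeasurableSpace α] {ν : Measure α}
    {u : Lp ℂ 2 ν} {f : α → ℂ} (hu : u =ᵐ[ν] f) : ‖u‖ ^ 2 = ∫ x, ‖f x‖ ^ 2 ∂ν := by
  have h (x : α) : conj (f x) * f x = ((‖f x‖ ^ 2 : ℝ) : ℂ) := by
    rw [Complex.ofReal_pow, Complex.conj_mul']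
  rw [← Complex.ofReal_inj, Complex.ofReal_pow, ← Complex.coe_algebraMap,
    ← inner_self_eq_norm_sq_to_K, inner_eq_integral_of_ae_eq hu hu]
  simp only [h]
  exact integral_ofReal

section Spectra

variable {G : Type*} [AddCommGroup G] [MeasurableSpace G]

/-- The Fourier coefficient at the character `χ` of the restriction of `f` to `Ω`, that is, the
inner product `⟪χ, f⟫` in `L²(Ω)`. -/
noncomputable def charCoeff (μ : Measure G) (Ω : Set G) (χ : AddChar G Circle) (f : G → ℂ) : ℂ :=
  ∫ x in Ω, conj (χ x : ℂ) * f x ∂μ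

variable {μ : Measure G} {Ω : Set G}

lemma charCoeff_indicator {S : Set G} (hS : MeasurableSet S) (hSΩ : S ⊆ Ω) (χ : AddChar G Circle)
    (f : G → ℂ) : charCoeff μ Ω χ (S.indicator f) = charCoeff μ S χ f := by
  have h : (fun x => conj (χ x : ℂ) * S.indicator f x) =
      S.indicator fun x => conj (χ x : ℂ) * f x :=
    funext fun _ => (Set.indicator_mul_right S (fun x => conj (χ x : ℂ)) f).symm
  rw [charCoeff, h, setIntegral_indicator hS, Set.inter_eq_right.mpr hSΩ, charCoeff]

lemma norm_sq_eq_of_ae_eq_character {u : Lp ℂ 2 (μ.restrict Ω)} {χ : AddChar G Circle}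
    (hu : u =ᵐ[μ.restrict Ω] fun x => (χ x : ℂ)) : ‖u‖ ^ 2 = μ.real Ω := by
  have h (x : G) : ‖(χ x : ℂ)‖ = 1 := Circle.norm_coe _
  simp [norm_sq_eq_integral_of_ae_eq hu, h]

variable [TopologicalSpace G] {Λ : Set (AddChar G Circle)}

lemma memLp_character [OpensMeasurableSpace G] [IsFiniteMeasure (μ.restrict Ω)]
    {χ : AddChar G Circle} (hχ : Continuous χ) (p : ENNReal) :
    MemLp (fun x => (χ x : ℂ)) p (μ.restrict Ω) :=
  .of_bound (continuous_subtype_val.comp hχ).aestronglyMeasurable 1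
    (.of_forall fun _ => (Circle.norm_coe _).le)

lemma isSpectrum_of_orthogonal_of_complete [OpensMeasurableSpace G]
    [IsFiniteMeasure (μ.restrict Ω)] (hΩ : Λ.Nonempty → μ Ω ≠ 0) (hcont : ∀ χ ∈ Λ, Continuous χ)
    (horth : Λ.Pairwise fun χ ψ => charCoeff μ Ω χ (fun x => ψ x) = 0)
    (hcomp : ∀ f : G → ℂ, MemLp f 2 (μ.restrict Ω) → (∀ χ ∈ Λ, charCoeff μ Ω χ f = 0) →
      f =ᵐ[μ.restrict Ω] 0) :
    IsSpectrum μ Ω Λ := by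
  have hae (χ : Λ) := (memLp_character (μ := μ) (Ω := Ω) (hcont χ χ.2) 2).coeFn_toLp
  refine ⟨hcont, fun χ => (memLp_character (hcont χ χ.2) 2).toLp _, hae, fun χ => ?_,
    fun χ ψ h => ?_, ?_⟩
  · have htop : μ Ω ≠ ⊤ := by simpa using measure_ne_top (μ.restrict Ω) Set.univ
    refine norm_ne_zero_iff.mp fun h => ENNReal.toReal_ne_zero.mpr ⟨hΩ ⟨χ, χ.2⟩, htop⟩ ?_
    rw [← measureReal_def, ← norm_sq_eq_of_ae_eq_character (hae χ), sq_eq_zero_iff]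
    exact h
  · rw [inner_eq_integral_of_ae_eq (hae χ) (hae ψ)]
    exact horth χ.2 ψ.2 (Subtype.coe_ne_coe.mpr h)
  · rw [Submodule.topologicalClosure_eq_top_iff, Submodule.eq_bot_iff]
    intro f hf
    rw [Lp.eq_zero_iff_ae_eq_zero]
    refine hcomp f (Lp.memLp f) fun χ hχ => ?_
    rw [charCoeff, ← inner_eq_integral_of_ae_eq (hae ⟨χ, hχ⟩) (ae_eq_refl _)]
    exact Submodule.inner_right_of_mem_orthogonal
      (Submodule.subset_span (Set.mem_range_self (⟨χ, hχ⟩ : Λ))) hf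

namespace IsSpectrum

lemma measure_ne_zero (h : IsSpectrum μ Ω Λ) (hΛ : Λ.Nonempty) : μ Ω ≠ 0 := by
  obtain ⟨-, v, hv, h0, -⟩ := h
  obtain ⟨χ, hχ⟩ := hΛ
  intro hΩ
  have hnorm := norm_sq_eq_of_ae_eq_character (hv ⟨χ, hχ⟩)
  rw [measureReal_def, hΩ, ENNReal.toReal_zero, sq_eq_zero_iff, norm_eq_zero] at hnorm
  exact h0 _ hnorm

lemma charCoeff_eq_zero (h : IsSpectrum μ Ω Λ) {χ ψ : AddChar G Circle} (hχ : χ ∈ Λ)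
    (hψ : ψ ∈ Λ) (hne : χ ≠ ψ) : charCoeff μ Ω χ (fun x => ψ x) = 0 := by
  obtain ⟨-, v, hv, -, ho, -⟩ := h
  rw [charCoeff, ← inner_eq_integral_of_ae_eq (hv ⟨χ, hχ⟩) (hv ⟨ψ, hψ⟩)]
  exact ho _ _ (Subtype.coe_ne_coe.mp hne)

lemma ae_eq_zero (h : IsSpectrum μ Ω Λ) {f : G → ℂ} (hf : MemLp f 2 (μ.restrict Ω))
    (h0 : ∀ χ ∈ Λ, charCoeff μ Ω χ f = 0) : f =ᵐ[μ.restrict Ω] 0 := by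
  obtain ⟨-, v, hv, -, -, hd⟩ := h
  have hf0 : hf.toLp f = 0 := by
    refine eq_zero_of_forall_inner_eq_zero (Submodule.dense_iff_topologicalClosure_eq_top.mpr hd)
      fun χ => ?_
    rw [inner_eq_integral_of_ae_eq (hv χ) hf.coeFn_toLp]
    exact h0 χ χ.2
  exact (MemLp.toLp_eq_toLp_iff hf MemLp.zero).mp hf0

lemma hasSum_norm_charCoeff_sq (h : IsSpectrum μ Ω Λ) {f : G → ℂ}
    (hf : MemLp f 2 (μ.restrict Ω)) :
    HasSum (fun χ : Λ => ‖charCoeff μ Ω χ f‖ ^ 2) (μ.real Ω * ∫ x in Ω, ‖f x‖ ^ 2 ∂μ) := by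
  obtain ⟨-, v, hv, h0, ho, hd⟩ := h
  rw [← norm_sq_eq_integral_of_ae_eq hf.coeFn_toLp]
  convert! (hasSum_norm_inner_sq_div_norm_sq h0 (fun _ _ => ho _ _) hd (hf.toLp f)).mul_left
    (μ.real Ω) using 1
  ext χ
  have hΩ : μ.real Ω ≠ 0 := by
    rw [← norm_sq_eq_of_ae_eq_character (hv χ)]
    exact pow_ne_zero 2 (norm_ne_zero_iff.mpr (h0 χ))
  rw [norm_sq_eq_of_ae_eq_character (hv χ), mul_div_cancel₀ _ hΩ,
    inner_eq_integral_of_ae_eq (hv χ) hf.coeFn_toLp, charCoeff]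

lemma countable [IsSeparable (μ.restrict Ω)] (h : IsSpectrum μ Ω Λ) : Countable Λ := by
  obtain ⟨-, v, -, h0, ho, -⟩ := h
  have : Fact ((2 : ENNReal) ≠ ⊤) := ⟨ENNReal.ofNat_ne_top⟩
  exact countable_of_pairwise_inner_eq_zero h0 fun _ _ => ho _ _

end IsSpectrum

end Spectra

/-! ### Finite subsets of discrete groups -/

section Finset

variable {α : Type*} [MeasurableSpace α] [MeasurableSingletonClass α]

instance isFiniteMeasure_count_restrict_finset (A : Finset α) :
    IsFiniteMeasure (Measure.count.restrict (A : Set α)) :=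
  ⟨by simp [Measure.count_apply_finset]⟩

lemma ae_count_restrict_iff {A : Finset α} {p : α → Prop} :
    (∀ᵐ a ∂Measure.count.restrict (A : Set α), p a) ↔ ∀ a ∈ A, p a := by
  rw [ae_restrict_iff' A.measurableSet, Measure.ae_count_iff]
  simp only [Finset.mem_coe]

lemma memLp_count_restrict {α : Type*} [MeasurableSpace α] [DiscreteMeasurableSpace α]
    (A : Finset α) (f : α → ℂ) (p : ENNReal) : MemLp f p (Measure.count.restrict (A : Set α)) :=
  .of_bound (Measurable.of_discrete).aestronglyMeasurable (∑ a ∈ A, ‖f a‖) <|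
    ae_count_restrict_iff.mpr fun _ ha =>
      Finset.single_le_sum (f := fun a => ‖f a‖) (fun _ _ => norm_nonneg _) ha

/-- The restriction of `f` to `A`, as a vector of the Euclidean space `ℂ^A`, which stands for
`L²(A)` with respect to the counting measure. -/
noncomputable def restrictVec {α : Type*} (A : Finset α) (f : α → ℂ) : EuclideanSpace ℂ A :=
  WithLp.toLp 2 fun a => f a

variable {G : Type*} [AddCommGroup G] [MeasurableSpace G] [DiscreteMeasurableSpace G]

lemma charCoeff_count (A : Finset G) (χ : AddChar G Circle) (f : G → ℂ) :
    charCoeff Measure.count A χ f = ∑ a ∈ A, conj (χ a : ℂ) * f a := by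
  rw [charCoeff, setIntegral_finset _ ((memLp_count_restrict A _ 1).integrable le_rfl)]
  simp [measureReal_def]

lemma inner_restrictVec (A : Finset G) (χ : AddChar G Circle) (f : G → ℂ) :
    inner ℂ (restrictVec A fun a => χ a) (restrictVec A f) = charCoeff Measure.count A χ f := by
  rw [charCoeff_count, ← Finset.sum_coe_sort A, PiLp.inner_apply]
  exact Finset.sum_congr rfl fun a _ => RCLike.inner_apply' _ _

lemma isSpectral_count_of_card [TopologicalSpace G] [DiscreteTopology G]
    {A : Finset G} {ι : Type*} [Fintype ι]
    (hcard : Fintype.card ι = A.card) (ψ : ι → AddChar G Circle)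
    (horth : Pairwise fun i j => charCoeff Measure.count A (ψ i) (fun a => ψ j a) = 0) :
    IsSpectral Measure.count (A : Set G) := by
  have nonempty (i : ι) : A.Nonempty :=
    Finset.card_pos.mp (hcard ▸ Fintype.card_pos_iff.mpr ⟨i⟩)
  have hne (i : ι) : (restrictVec A fun a => ψ i a) ≠ 0 := by
    obtain ⟨a, ha⟩ := nonempty i
    exact fun h => Circle.coe_ne_zero (ψ i a) (congrArg (· ⟨a, ha⟩) h)
  have hspan := (linearIndependent_of_ne_zero_of_inner_eq_zero hne fun i j hij =>
    (inner_restrictVec A _ _).trans (horth hij)).span_eq_top_of_card_eq_finrank'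
      (by rw [hcard, finrank_euclideanSpace, Fintype.card_coe])
  refine ⟨Set.range ψ, isSpectrum_of_orthogonal_of_complete ?_
    (fun _ _ => continuous_of_discreteTopology) ?_ fun f _ hf => ?_⟩
  · rintro ⟨_, i, rfl⟩
    simpa [Measure.count_apply_finset] using (nonempty i).ne_empty
  · rintro _ ⟨i, rfl⟩ _ ⟨j, rfl⟩ hij
    exact horth fun h => hij (congrArg ψ h)
  · have hf0 : restrictVec A f = 0 :=
      eq_zero_of_forall_inner_eq_zero (by rw [hspan]; exact dense_univ) fun i => by
        rw [inner_restrictVec, hf _ ⟨i, rfl⟩]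
    exact ae_count_restrict_iff.mpr fun a ha => congrArg (· ⟨a, ha⟩) hf0

end Finset

/-! ### The Fourier transform of the unit cube -/

section UnitCube

variable {d : ℕ}

lemma mem_unitCube {x : Fin d → ℝ} : x ∈ unitCube d ↔ ∀ i, x i ∈ Set.Ico 0 1 :=
  Set.mem_univ_pi

lemma measurableSet_unitCube (d : ℕ) : MeasurableSet (unitCube d) :=
  MeasurableSet.univ_pi fun _ => measurableSet_Ico

lemma volume_unitCube (d : ℕ) : volume (unitCube d) = 1 := by
  simp [unitCube, volume_pi_pi]

instance isFiniteMeasure_restrict_unitCube (d : ℕ) :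
    IsFiniteMeasure (volume.restrict (unitCube d)) :=
  ⟨by simp [volume_unitCube]⟩

/-- The Fourier transform of the indicator function of the unit cube, with the sign convention
`t ↦ ∫ exp (2πi t·x) dx`. -/
noncomputable def cubeFourier (t : Fin d → ℝ) : ℂ :=
  ∫ x in unitCube d, (expChar t x : ℂ)

lemma cubeFourier_eq_prod (t : Fin d → ℝ) :
    cubeFourier t = ∏ i, ∫ x in (0 : ℝ)..1, (Real.fourierChar (t i * x) : ℂ) := by
  simp only [cubeFourier, coe_expChar_eq_prod]
  rw [volume_pi, unitCube, Measure.restrict_pi_pi,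
    integral_fintype_prod_eq_prod (fun i (x : ℝ) => (Real.fourierChar (t i * x) : ℂ))]
  refine Finset.prod_congr rfl fun i _ => ?_
  rw [intervalIntegral.integral_of_le zero_le_one, integral_Ico_eq_integral_Ioc]

lemma intervalIntegral_fourierChar {s : ℝ} (hs : s ≠ 0) :
    ∫ x in (0 : ℝ)..1, (Real.fourierChar (s * x) : ℂ) =
      (Real.fourierChar s - 1) / (2 * Real.pi * s * Complex.I) := by
  have hc : (2 * Real.pi * s * Complex.I : ℂ) ≠ 0 := by simp [hs, Real.pi_ne_zero]
  have h := integral_exp_mul_complex (a := 0) (b := 1) hc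
  simp only [Complex.ofReal_zero, mul_zero, Complex.exp_zero, Complex.ofReal_one, mul_one] at h
  simp only [Real.fourierChar_apply]
  push_cast
  rw [← h]
  exact intervalIntegral.integral_congr fun x _ => by ring_nf

lemma intervalIntegral_fourierChar_eq_zero_iff {s : ℝ} :
    ∫ x in (0 : ℝ)..1, (Real.fourierChar (s * x) : ℂ) = 0 ↔ ∃ n : ℤ, n ≠ 0 ∧ s = n := by
  rcases eq_or_ne s 0 with rfl | hs
  · simp +contextual [eq_comm]
  rw [intervalIntegral_fourierChar hs, div_eq_zero_iff, or_iff_left (by simp [hs, Real.pi_ne_zero]),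
    sub_eq_zero, Circle.coe_eq_one, fourierChar_eq_one_iff]
  refine exists_congr fun n => (and_iff_right_of_imp ?_).symm
  rintro rfl
  exact_mod_cast hs

lemma cubeFourier_eq_zero_iff {t : Fin d → ℝ} :
    cubeFourier t = 0 ↔ ∃ i, ∃ n : ℤ, n ≠ 0 ∧ t i = n := by
  simp [cubeFourier_eq_prod, Finset.prod_eq_zero_iff, intervalIntegral_fourierChar_eq_zero_iff]

lemma cubeFourier_intVec {n : Fin d → ℤ} (hn : n ≠ 0) : cubeFourier (intVec n) = 0 := by
  obtain ⟨i, hi⟩ := Function.ne_iff.mp hn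
  exact cubeFourier_eq_zero_iff.mpr ⟨i, n i, hi, intVec_apply n i⟩

lemma cubeFourier_sub_ne_zero {s t : Fin d → ℝ} (hs : s ∈ unitCube d) (ht : t ∈ unitCube d) :
    cubeFourier (t - s) ≠ 0 := by
  rw [Ne, cubeFourier_eq_zero_iff]
  rintro ⟨i, n, hn, h⟩
  have hsi := mem_unitCube.mp hs i
  have hti := mem_unitCube.mp ht i
  rw [Pi.sub_apply] at h
  have hlt : |(n : ℝ)| < 1 := by
    rw [← h, abs_lt]
    constructor <;> linarith [hsi.1, hsi.2, hti.1, hti.2]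
  exact hn (Int.abs_lt_one_iff.mp (by exact_mod_cast hlt))

lemma continuous_cubeFourier (d : ℕ) : Continuous (cubeFourier (d := d)) := by
  refine continuous_of_dominated (bound := fun _ => 1) (fun t => ?_) (fun t => ?_)
    (integrable_const _) (.of_forall fun x => ?_)
  · exact (continuous_subtype_val.comp (continuous_expChar t)).aestronglyMeasurable
  · exact .of_forall fun x => (Circle.norm_coe _).le
  · exact continuous_subtype_val.comp (continuous_expChar_apply.comp (.prodMk_left x))

lemma mem_intVec_vadd_unitCube {n : Fin d → ℤ} {x : Fin d → ℝ} :
    x ∈ intVec n +ᵥ unitCube d ↔ (fun i => ⌊x i⌋) = n := by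
  rw [Set.mem_vadd_set_iff_neg_vadd_mem, mem_unitCube, funext_iff]
  refine forall_congr' fun i => ?_
  rw [Int.floor_eq_iff, vadd_eq_add, Pi.add_apply, Pi.neg_apply, intVec_apply, Set.mem_Ico]
  constructor <;> rintro ⟨h1, h2⟩ <;> constructor <;> linarith

lemma measurableSet_vadd_unitCube (x : Fin d → ℝ) : MeasurableSet (x +ᵥ unitCube d) :=
  (measurableSet_unitCube d).const_vadd x

lemma pairwise_disjoint_vadd_unitCube (d : ℕ) :
    Pairwise (Function.onFun Disjoint fun n : Fin d → ℤ => intVec n +ᵥ unitCube d) :=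
  fun _ _ hmn => Set.disjoint_left.mpr fun _ hm hn =>
    hmn ((mem_intVec_vadd_unitCube.mp hm).symm.trans (mem_intVec_vadd_unitCube.mp hn))

lemma iUnion_vadd_unitCube (d : ℕ) : ⋃ n : Fin d → ℤ, intVec n +ᵥ unitCube d = Set.univ :=
  Set.eq_univ_of_forall fun _ => Set.mem_iUnion.mpr ⟨_, mem_intVec_vadd_unitCube.mpr rfl⟩

lemma map_add_left_restrict {G : Type*} [AddGroup G] [MeasurableSpace G] [MeasurableAdd G]
    (μ : Measure G) [μ.IsAddLeftInvariant] (x : G) (S : Set G) :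
    (μ.restrict S).map (x + ·) = μ.restrict (x +ᵥ S) :=
  ((measurePreserving_add_left μ x).restrict_image_emb (measurableEmbedding_addLeft x) S).map_eq

lemma volume_eq_sum_map_unitCube (d : ℕ) :
    (volume : Measure (Fin d → ℝ)) =
      Measure.sum fun n => (volume.restrict (unitCube d)).map (intVec n + ·) := by
  simp only [map_add_left_restrict]
  rw [← Measure.restrict_iUnion (pairwise_disjoint_vadd_unitCube d)
    fun _ => measurableSet_vadd_unitCube _, iUnion_vadd_unitCube, Measure.restrict_univ]

lemma lintegral_eq_tsum_unitCube (f : (Fin d → ℝ) → ENNReal) :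
    ∫⁻ x, f x = ∑' n : Fin d → ℤ, ∫⁻ x in unitCube d, f (intVec n + x) := by
  conv_lhs => rw [volume_eq_sum_map_unitCube, lintegral_sum_measure]
  exact tsum_congr fun n => (measurableEmbedding_addLeft _).lintegral_map _

end UnitCube

/-! ### Finite unions of lattice cubes -/

section CubeUnion

variable {d : ℕ}

/-- The set `A + [0,1)^d` as the union of the unit cubes with lower corners in `A`. -/
def cubeUnion (A : Finset (Fin d → ℤ)) : Set (Fin d → ℝ) :=
  ⋃ a ∈ A, intVec a +ᵥ unitCube d

variable {A : Finset (Fin d → ℤ)}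

lemma latticeToReal_add_unitCube (A : Finset (Fin d → ℤ)) :
    latticeToReal d A + unitCube d = cubeUnion A := by
  rw [cubeUnion, ← Set.iUnion_add_left_image, latticeToReal, Set.biUnion_image]
  rfl

lemma vadd_unitCube_subset_cubeUnion {a : Fin d → ℤ} (ha : a ∈ A) :
    intVec a +ᵥ unitCube d ⊆ cubeUnion A :=
  Set.subset_biUnion_of_mem (u := fun a => intVec a +ᵥ unitCube d) (Finset.mem_coe.mpr ha)

lemma cubeUnion_singleton (a : Fin d → ℤ) : cubeUnion {a} = intVec a +ᵥ unitCube d := by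
  simp [cubeUnion]

lemma restrict_cubeUnion (A : Finset (Fin d → ℤ)) :
    volume.restrict (cubeUnion A) =
      ∑ a ∈ A, (volume.restrict (unitCube d)).map (intVec a + ·) := by
  simp only [map_add_left_restrict]
  rw [cubeUnion, Measure.restrict_biUnion_finset
    ((pairwise_disjoint_vadd_unitCube d).set_pairwise _) fun _ => measurableSet_vadd_unitCube _,
    Measure.sum_fintype, Finset.sum_coe_sort A fun a => volume.restrict (intVec a +ᵥ unitCube d)]

lemma volume_cubeUnion (A : Finset (Fin d → ℤ)) : volume (cubeUnion A) = A.card := by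
  rw [← Measure.restrict_apply_univ, restrict_cubeUnion, Measure.finsetSum_apply]
  simp [map_add_left_restrict, measure_vadd, volume_unitCube]

instance isFiniteMeasure_restrict_cubeUnion (A : Finset (Fin d → ℤ)) :
    IsFiniteMeasure (volume.restrict (cubeUnion A)) :=
  ⟨by simp [volume_cubeUnion]⟩

lemma ae_restrict_cubeUnion_iff {p : (Fin d → ℝ) → Prop} :
    (∀ᵐ x ∂volume.restrict (cubeUnion A), p x) ↔
      ∀ a ∈ A, ∀ᵐ x ∂volume.restrict (unitCube d), p (intVec a + x) := by
  simp only [restrict_cubeUnion, ae_finsetSum_measure_iff,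
    (measurableEmbedding_addLeft _).ae_map_iff]

lemma memLp_comp_add_of_memLp_cubeUnion {E : Type*} [NormedAddCommGroup E] {p : ENNReal}
    {f : (Fin d → ℝ) → E} (hf : MemLp f p (volume.restrict (cubeUnion A))) {a : Fin d → ℤ}
    (ha : a ∈ A) : MemLp (fun x => f (intVec a + x)) p (volume.restrict (unitCube d)) := by
  refine MemLp.comp_of_map ?_ (measurable_const_add (intVec a)).aemeasurable
  rw [map_add_left_restrict]
  exact hf.mono_measure (Measure.restrict_mono (vadd_unitCube_subset_cubeUnion ha) le_rfl)

lemma setIntegral_cubeUnion {E : Type*} [NormedAddCommGroup E] [NormedSpace ℝ E]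
    {f : (Fin d → ℝ) → E} (hf : IntegrableOn f (cubeUnion A)) :
    ∫ x in cubeUnion A, f x = ∑ a ∈ A, ∫ x in unitCube d, f (intVec a + x) := by
  rw [IntegrableOn, restrict_cubeUnion, integrable_finsetSum_measure] at hf
  rw [restrict_cubeUnion, integral_finsetSum_measure hf]
  exact Finset.sum_congr rfl fun a _ => (measurableEmbedding_addLeft _).integral_map _

/-- Writing points of `A + [0,1)^d` as `a + x` separates the variables of a character. -/
lemma charCoeff_cubeUnion (t : Fin d → ℝ) {f : (Fin d → ℝ) → ℂ}
    (hf : MemLp f 2 (volume.restrict (cubeUnion A))) :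
    charCoeff volume (cubeUnion A) (expChar t) f =
      charCoeff volume (unitCube d) (expChar t) fun x =>
        charCoeff Measure.count A (latticeChar t) fun a => f (intVec a + x) := by
  have hint : IntegrableOn (fun x => conj (expChar t x : ℂ) * f x) (cubeUnion A) :=
    (memLp_character (continuous_expChar t) 2).star.integrable_mul hf
  rw [charCoeff, setIntegral_cubeUnion hint, charCoeff]
  simp only [charCoeff_count, Finset.mul_sum]
  rw [integral_finsetSum]
  · refine Finset.sum_congr rfl fun a _ => integral_congr_ae (.of_forall fun x => ?_)
    simp only [AddChar.map_add_eq_mul, Circle.coe_mul, map_mul, expChar_intVec]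
    ring
  · exact fun a ha => (memLp_character (continuous_expChar t) 2).star.integrable_mul
      ((memLp_comp_add_of_memLp_cubeUnion hf ha).const_mul _)

lemma charCoeff_cubeUnion_expChar (A : Finset (Fin d → ℤ)) (s t : Fin d → ℝ) :
    charCoeff volume (cubeUnion A) (expChar s) (fun x => expChar t x) =
      charCoeff Measure.count A (latticeChar s) (fun a => latticeChar t a) *
        cubeFourier (t - s) := by
  have h (x : Fin d → ℝ) : (charCoeff Measure.count A (latticeChar s) fun a =>
      (expChar t (intVec a + x) : ℂ)) =
      charCoeff Measure.count A (latticeChar s) (fun a => latticeChar t a) * expChar t x := by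
    simp only [charCoeff, AddChar.map_add_eq_mul, Circle.coe_mul, expChar_intVec, ← mul_assoc]
    rw [integral_mul_const]
  rw [charCoeff_cubeUnion s (memLp_character (continuous_expChar t) 2)]
  simp only [h]
  rw [charCoeff, cubeFourier, ← integral_const_mul]
  simp only [← conj_expChar_mul_expChar]
  exact integral_congr_ae (.of_forall fun x => mul_left_comm _ _ _)

end CubeUnion

/-! ### Fourier series on the unit cube -/

section Torus

attribute [local instance] instMeasureSpaceUnitAddCircle

open UnitAddTorus

variable {d : ℕ}

/-- The section of the quotient map `ℝ^d → ℝ^d / ℤ^d` with values in `(0,1]^d`, which agrees with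
the unit cube up to a null set. -/
noncomputable def torusSection (z : UnitAddTorus (Fin d)) : Fin d → ℝ :=
  (measurableEquivPiIoc 0 z).1

lemma coe_torusSection (z : UnitAddTorus (Fin d)) (i : Fin d) :
    (torusSection z i : UnitAddCircle) = z i :=
  congrFun ((measurableEquivPiIoc 0).symm_apply_apply z) i

lemma measurableEmbedding_torusSection : MeasurableEmbedding (torusSection (d := d)) :=
  (MeasurableEmbedding.subtype_coe (.univ_pi' fun _ => measurableSet_Ioc)).comp
    (measurableEquivPiIoc 0).measurableEmbedding

lemma unitCube_ae_eq_Ioc (d : ℕ) :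
    unitCube d =ᵐ[volume] {x | ∀ i, x i ∈ Set.Ioc ((0 : Fin d → ℝ) i) ((0 : Fin d → ℝ) i + 1)} := by
  have h := (Measure.univ_pi_Ico_ae_eq_Icc (μ := fun _ : Fin d => (volume : Measure ℝ))
    (f := 0) (g := 1)).trans Measure.univ_pi_Ioc_ae_eq_Icc.symm
  rw [← volume_pi] at h
  have hset : {x | ∀ i, x i ∈ Set.Ioc ((0 : Fin d → ℝ) i) ((0 : Fin d → ℝ) i + 1)} =
      Set.univ.pi fun i => Set.Ioc ((0 : Fin d → ℝ) i) ((1 : Fin d → ℝ) i) := by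
    ext x
    simp
  rw [hset]
  exact h

lemma measurePreserving_torusSection :
    MeasurePreserving torusSection volume (volume.restrict (unitCube d)) := by
  rw [Measure.restrict_congr_set (unitCube_ae_eq_Ioc d)]
  have hval := map_comap_subtype_coe
    (MeasurableSet.univ_pi' fun i => measurableSet_Ioc (a := (0 : Fin d → ℝ) i)
      (b := (0 : Fin d → ℝ) i + 1)) volume
  exact MeasurePreserving.comp ⟨measurable_subtype_coe, hval⟩ (measurePreserving_equivPiIoc 0)

lemma mFourier_eq_expChar_torusSection (n : Fin d → ℤ) (z : UnitAddTorus (Fin d)) :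
    mFourier n z = expChar (intVec n) (torusSection z) := by
  rw [coe_expChar_eq_prod, mFourier, ContinuousMap.coe_mk]
  refine Finset.prod_congr rfl fun i _ => ?_
  rw [← coe_torusSection z i, fourier_coe_apply, Real.fourierChar_apply, intVec_apply]
  push_cast
  ring_nf

lemma mFourierCoeff_comp_torusSection (f : (Fin d → ℝ) → ℂ) (n : Fin d → ℤ) :
    mFourierCoeff (fun z => f (torusSection z)) n =
      charCoeff volume (unitCube d) (expChar (intVec n)) f := by
  rw [charCoeff, ← measurePreserving_torusSection.integral_comp measurableEmbedding_torusSection]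
  simp only [mFourierCoeff, mFourier_neg, mFourier_eq_expChar_torusSection, smul_eq_mul]

lemma hasSum_norm_charCoeff_unitCube_sq {f : (Fin d → ℝ) → ℂ}
    (hf : MemLp f 2 (volume.restrict (unitCube d))) :
    HasSum (fun n => ‖charCoeff volume (unitCube d) (expChar (intVec n)) f‖ ^ 2)
      (∫ x in unitCube d, ‖f x‖ ^ 2) := by
  have hg := hf.comp_measurePreserving measurePreserving_torusSection
  have hcoeff (n : Fin d → ℤ) : mFourierCoeff (hg.toLp _) n =
      charCoeff volume (unitCube d) (expChar (intVec n)) f := by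
    rw [← mFourierCoeff_comp_torusSection]
    refine integral_congr_ae ?_
    filter_upwards [hg.coeFn_toLp] with z hz
    rw [hz, Function.comp_apply]
  have hnorm : ∫ z, ‖hg.toLp _ z‖ ^ 2 = ∫ x in unitCube d, ‖f x‖ ^ 2 := by
    rw [← measurePreserving_torusSection.integral_comp measurableEmbedding_torusSection]
    refine integral_congr_ae ?_
    filter_upwards [hg.coeFn_toLp] with z hz
    rw [hz, Function.comp_apply]
  simpa only [hcoeff, hnorm] using hasSum_sq_mFourierCoeff (hg.toLp _)

end Torus

section CubeSeries

variable {d : ℕ}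

lemma ae_eq_zero_of_charCoeff_unitCube_eq_zero {f : (Fin d → ℝ) → ℂ}
    (hf : MemLp f 2 (volume.restrict (unitCube d)))
    (h : ∀ n, charCoeff volume (unitCube d) (expChar (intVec n)) f = 0) :
    f =ᵐ[volume.restrict (unitCube d)] 0 := by
  have hsum := hasSum_norm_charCoeff_unitCube_sq hf
  simp only [h, norm_zero, ne_eq, OfNat.ofNat_ne_zero, not_false_eq_true, zero_pow] at hsum
  have hint := hsum.unique hasSum_zero
  rw [integral_eq_zero_iff_of_nonneg (fun _ => by positivity)
    (hf.integrable_norm_pow two_ne_zero)] at hint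
  filter_upwards [hint] with x hx
  simpa using hx

lemma tsum_enorm_cubeFourier_sq (x : Fin d → ℝ) :
    ∑' n, ‖cubeFourier (intVec n + x)‖ₑ ^ 2 = 1 := by
  have hcoeff (n : Fin d → ℤ) :
      charCoeff volume (unitCube d) (expChar (intVec (-n))) (fun y => expChar x y) =
        cubeFourier (intVec n + x) := by
    simp only [charCoeff, conj_expChar_mul_expChar, map_neg, sub_neg_eq_add, add_comm x]
    rfl
  have hnorm (y : Fin d → ℝ) : ‖(expChar x y : ℂ)‖ = 1 := Circle.norm_coe _
  have hsum := (Equiv.neg _).hasSum_iff.mpr <|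
    hasSum_norm_charCoeff_unitCube_sq (memLp_character (continuous_expChar x) 2)
  simp only [Function.comp_def, Equiv.neg_apply, hcoeff, hnorm, integral_const,
    measureReal_def, Measure.restrict_apply_univ, volume_unitCube] at hsum
  simp only [← ofReal_norm, ← ENNReal.ofReal_pow (norm_nonneg _)]
  rw [← ENNReal.ofReal_tsum_of_nonneg (fun _ => by positivity) hsum.summable, hsum.tsum_eq]
  simp

lemma lintegral_enorm_cubeFourier_sq (d : ℕ) :
    ∫⁻ x : Fin d → ℝ, ‖cubeFourier x‖ₑ ^ 2 = 1 := by
  have hmeas (n : Fin d → ℤ) : Measurable fun x => ‖cubeFourier (intVec n + x)‖ₑ ^ 2 :=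
    ((continuous_cubeFourier d).comp (continuous_const_add _)).enorm.measurable.pow_const 2
  rw [lintegral_eq_tsum_unitCube, ← lintegral_tsum fun n => (hmeas n).aemeasurable]
  simp only [tsum_enorm_cubeFourier_sq, lintegral_one, Measure.restrict_apply_univ, volume_unitCube]

end CubeSeries

section Averaging

variable {G ι : Type*} [AddGroup G] [MeasurableSpace G] [MeasurableAdd G] {μ : Measure G}
  [μ.IsAddRightInvariant] [Countable ι]

lemma setLIntegral_tsum_sub {Q : Set G} (hQ : MeasurableSet Q) {g : G → ENNReal}
    (hg : Measurable g) (ξ : ι → G) :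
    ∫⁻ η in Q, ∑' i, g (η - ξ i) ∂μ = ∫⁻ t, {i | t + ξ i ∈ Q}.encard * g t ∂μ := by
  have hshift (i : ι) : Measurable fun η => g (η - ξ i) := by
    simp only [sub_eq_add_neg]
    exact hg.comp (measurable_add_const (-ξ i))
  have hmask (i : ι) : Measurable fun t => Q.indicator 1 (t + ξ i) * g t :=
    ((measurable_one.indicator hQ).comp (measurable_add_const _)).mul hg
  have hcount (t : G) :
      ∑' i, Q.indicator 1 (t + ξ i) * g t = {i | t + ξ i ∈ Q}.encard * g t := by
    rw [ENNReal.tsum_mul_right, ← ENNReal.tsum_set_one, tsum_subtype _ fun _ => 1]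
    rfl
  simp only [← hcount]
  rw [lintegral_tsum fun i => (hshift i).aemeasurable,
    lintegral_tsum fun i => (hmask i).aemeasurable]
  refine tsum_congr fun i => ?_
  rw [← lintegral_indicator hQ, ← lintegral_add_right_eq_self _ (ξ i)]
  refine lintegral_congr fun t => ?_
  by_cases ht : t + ξ i ∈ Q <;> simp [ht]

/-- Pigeonhole by averaging: the `μ`-average over `Q` of `∑' i, g (η - ξ i)` is the `g`-weighted
average over `t` of the number of points `t + ξ i` in `Q`. -/
lemma exists_le_encard_of_le_tsum_sub {Q : Set G} (hQ : MeasurableSet Q) (hQ0 : μ Q ≠ 0)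
    (hQtop : μ Q ≠ ⊤) {g : G → ENNReal} (hg : Measurable g) (hgQ : ∫⁻ t, g t ∂μ ≤ μ Q) {ξ : ι → G}
    {N : ℕ} (hN : ∀ η ∈ Q, N ≤ ∑' i, g (η - ξ i)) : ∃ t, N ≤ {i | t + ξ i ∈ Q}.encard := by
  by_contra! hlt
  have hpos : 0 < N := Nat.cast_pos.mp (bot_le.trans_lt (hlt 0))
  have hpred (t : G) : ({i | t + ξ i ∈ Q}.encard : ENNReal) ≤ (N - 1 : ℕ) := by
    rw [← ENat.toENNReal_coe, ENat.toENNReal_le]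
    refine Order.le_of_lt_add_one ((hlt t).trans_eq ?_)
    exact_mod_cast (Nat.sub_add_cancel hpos).symm
  have key : N * μ Q ≤ (N - 1 : ℕ) * μ Q := calc
    N * μ Q = ∫⁻ _ in Q, N ∂μ := (setLIntegral_const _ _).symm
    _ ≤ ∫⁻ η in Q, ∑' i, g (η - ξ i) ∂μ := setLIntegral_mono' hQ hN
    _ = ∫⁻ t, {i | t + ξ i ∈ Q}.encard * g t ∂μ := setLIntegral_tsum_sub hQ hg ξ
    _ ≤ ∫⁻ t, (N - 1 : ℕ) * g t ∂μ := lintegral_mono fun t => by gcongr; exact hpred t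
    _ = (N - 1 : ℕ) * ∫⁻ t, g t ∂μ := lintegral_const_mul _ hg
    _ ≤ (N - 1 : ℕ) * μ Q := by gcongr
  rw [ENNReal.mul_le_mul_iff_left hQ0 hQtop, Nat.cast_le] at key
  lia

end Averaging

/-! ### Transferring spectra -/

section Transfer

variable {d : ℕ} {A : Finset (Fin d → ℤ)}

lemma charCoeff_add_intVec_cubeUnion (t : Fin d → ℝ) (n : Fin d → ℤ) {f : (Fin d → ℝ) → ℂ}
    (hf : MemLp f 2 (volume.restrict (cubeUnion A))) :
    charCoeff volume (cubeUnion A) (expChar (t + intVec n)) f =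
      charCoeff volume (unitCube d) (expChar (intVec n)) fun x =>
        conj (expChar t x : ℂ) *
          charCoeff Measure.count A (latticeChar t) fun a => f (intVec a + x) := by
  rw [charCoeff_cubeUnion _ hf, latticeChar_add_intVec]
  refine integral_congr_ae (.of_forall fun x => ?_)
  simp only [expChar_add_apply, Circle.coe_mul, map_mul]
  ring

lemma ae_charCoeff_count_eq_zero {t : Fin d → ℝ} {f : (Fin d → ℝ) → ℂ}
    (hf : MemLp f 2 (volume.restrict (cubeUnion A)))
    (h : ∀ n, charCoeff volume (cubeUnion A) (expChar (t + intVec n)) f = 0) :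
    ∀ᵐ x ∂volume.restrict (unitCube d),
      charCoeff Measure.count A (latticeChar t) (fun a => f (intVec a + x)) = 0 := by
  have hcoeff : MemLp (fun x => charCoeff Measure.count A (latticeChar t) fun a =>
      f (intVec a + x)) 2 (volume.restrict (unitCube d)) := by
    simp only [charCoeff_count]
    exact memLp_finsetSum A fun a ha => (memLp_comp_add_of_memLp_cubeUnion hf ha).const_mul _
  have hzero := ae_eq_zero_of_charCoeff_unitCube_eq_zero
    (hcoeff.mul (memLp_character (continuous_expChar t) ⊤).star) fun n =>
      (charCoeff_add_intVec_cubeUnion t n hf).symm.trans (h n)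
  filter_upwards [hzero] with x hx
  exact (mul_eq_zero.mp hx).resolve_left (star_ne_zero.mpr (Circle.coe_ne_zero _))

lemma IsSpectrum.cubeUnion {Λ : Set (AddChar (Fin d → ℤ) Circle)}
    (h : IsSpectrum Measure.count (A : Set (Fin d → ℤ)) Λ) :
    IsSpectrum volume (cubeUnion A) {χ | ∃ t, latticeChar t ∈ Λ ∧ χ = expChar t} := by
  refine isSpectrum_of_orthogonal_of_complete ?_ ?_ ?_ fun f hf h0 => ?_
  · rintro ⟨-, t, ht, -⟩
    have hA := h.measure_ne_zero ⟨_, ht⟩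
    rwa [volume_cubeUnion, ← Measure.count_apply_finset]
  · rintro _ ⟨t, -, rfl⟩
    exact continuous_expChar t
  · rintro _ ⟨s, hs, rfl⟩ _ ⟨t, ht, rfl⟩ hne
    rw [charCoeff_cubeUnion_expChar, mul_eq_zero]
    by_cases hst : latticeChar s = latticeChar t
    · obtain ⟨n, rfl⟩ := exists_eq_add_intVec_of_latticeChar_eq hst
      right
      rw [add_sub_cancel_left]
      refine cubeFourier_intVec ?_
      rintro rfl
      simp at hne
    · exact .inl (h.charCoeff_eq_zero hs ht hst)
  · have hΛ := h.countable
    have hcoeff (χ : Λ) : ∀ᵐ x ∂volume.restrict (unitCube d),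
        charCoeff Measure.count A χ (fun a => f (intVec a + x)) = 0 := by
      obtain ⟨χ, hχ⟩ := χ
      obtain ⟨t, rfl⟩ := exists_eq_latticeChar χ
      exact ae_charCoeff_count_eq_zero hf fun n =>
        h0 _ ⟨_, by rwa [latticeChar_add_intVec], rfl⟩
    refine ae_restrict_cubeUnion_iff.mpr fun a ha => ?_
    filter_upwards [ae_all_iff.mpr hcoeff] with x hx
    exact ae_count_restrict_iff.mp
      (h.ae_eq_zero (memLp_count_restrict A _ 2) fun χ hχ => hx ⟨χ, hχ⟩) a ha

lemma charCoeff_cubeUnion_indicator {a : Fin d → ℤ} (ha : a ∈ A) (s t : Fin d → ℝ) :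
    charCoeff volume (cubeUnion A) (expChar s)
        ((intVec a +ᵥ unitCube d).indicator fun x => expChar t x) =
      latticeChar (t - s) a * cubeFourier (t - s) := by
  rw [charCoeff_indicator (measurableSet_vadd_unitCube _) (vadd_unitCube_subset_cubeUnion ha),
    ← cubeUnion_singleton, charCoeff_cubeUnion_expChar, charCoeff_count, Finset.sum_singleton,
    ← expChar_intVec, ← expChar_intVec, conj_expChar_mul_expChar, expChar_intVec]

/-- Parseval's identity in `L²(A + [0,1)^d)` for `x ↦ exp (2πi η·x)` cut off to a single cube. -/
lemma tsum_enorm_cubeFourier_sub_sq {Λ : Set (AddChar (Fin d → ℝ) Circle)}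
    (h : IsSpectrum volume (cubeUnion A) Λ) (hA : A.Nonempty) {ξ : Λ → Fin d → ℝ}
    (hξ : ∀ χ : Λ, (χ : AddChar (Fin d → ℝ) Circle) = expChar (ξ χ)) (η : Fin d → ℝ) :
    ∑' χ, ‖cubeFourier (η - ξ χ)‖ₑ ^ 2 = A.card := by
  obtain ⟨a, ha⟩ := hA
  have hQ := measurableSet_vadd_unitCube (intVec a)
  have hsum := h.hasSum_norm_charCoeff_sq ((memLp_character (continuous_expChar η) 2).indicator hQ)
  have hcoeff (χ : Λ) : ‖charCoeff volume (cubeUnion A) χ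
      ((intVec a +ᵥ unitCube d).indicator fun x => expChar η x)‖ = ‖cubeFourier (η - ξ χ)‖ := by
    rw [hξ, charCoeff_cubeUnion_indicator ha, norm_mul, Circle.norm_coe, one_mul]
  have hnorm : ∫ x in cubeUnion A,
      ‖(intVec a +ᵥ unitCube d).indicator (fun x => (expChar η x : ℂ)) x‖ ^ 2 = 1 := by
    have h1 (x : Fin d → ℝ) : ‖(intVec a +ᵥ unitCube d).indicator
        (fun x => (expChar η x : ℂ)) x‖ ^ 2 = (intVec a +ᵥ unitCube d).indicator 1 x := by
      have hnorm : ‖(expChar η x : ℂ)‖ = 1 := Circle.norm_coe _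
      by_cases hx : x ∈ intVec a +ᵥ unitCube d <;> simp [hx, hnorm]
    simp only [h1]
    rw [integral_indicator_one hQ, measureReal_restrict_apply hQ,
      Set.inter_eq_left.mpr (vadd_unitCube_subset_cubeUnion ha), measureReal_def, measure_vadd,
      volume_unitCube, ENNReal.toReal_one]
  simp only [hcoeff, hnorm, measureReal_def, volume_cubeUnion, ENNReal.toReal_natCast, mul_one]
    at hsum
  simp only [← ofReal_norm, ← ENNReal.ofReal_pow (norm_nonneg _)]
  rw [← ENNReal.ofReal_tsum_of_nonneg (fun _ => by positivity) hsum.summable, hsum.tsum_eq,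
    ENNReal.ofReal_natCast]

lemma isSpectral_count_of_isSpectral_cubeUnion (h : IsSpectral volume (cubeUnion A)) :
    IsSpectral Measure.count (A : Set (Fin d → ℤ)) := by
  rcases A.eq_empty_or_nonempty with rfl | hA
  · exact isSpectral_count_of_card (ι := Fin 0) rfl Fin.elim0 Subsingleton.pairwise
  obtain ⟨Λ, hΛ⟩ := h
  have hcount := hΛ.countable
  choose ξ hξ using fun χ : Λ => exists_eq_expChar χ.1 (hΛ.1 χ χ.2)
  obtain ⟨x, hx⟩ := exists_le_encard_of_le_tsum_sub (μ := volume) (measurableSet_unitCube d)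
    (by simp [volume_unitCube]) (by simp [volume_unitCube])
    ((continuous_cubeFourier d).enorm.measurable.pow_const 2)
    (by rw [lintegral_enorm_cubeFourier_sq, volume_unitCube])
    fun η _ => (tsum_enorm_cubeFourier_sub_sq hΛ hA hξ η).ge
  obtain ⟨S, hS, hScard⟩ := Set.exists_subset_encard_eq hx
  have hSfin := Set.finite_of_encard_eq_coe hScard
  lift S to Finset Λ using hSfin
  rw [Set.encard_coe_eq_coe_finsetCard, Nat.cast_inj] at hScard
  refine isSpectral_count_of_card ((Fintype.card_coe S).trans hScard)
    (fun χ => latticeChar (ξ χ)) fun χ ψ hne => ?_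
  have horth := hΛ.charCoeff_eq_zero χ.1.2 ψ.1.2 fun h =>
    hne (Subtype.ext (Subtype.ext h))
  rw [hξ χ.1, hξ ψ.1, charCoeff_cubeUnion_expChar] at horth
  refine (mul_eq_zero.mp horth).resolve_right ?_
  rw [← add_sub_add_left_eq_sub (ξ ψ) (ξ χ) x]
  exact cubeFourier_sub_ne_zero (hS χ.2) (hS ψ.2)

end Transfer

theorem theorem4p2 (d : ℕ) (A : Set (Fin d → ℤ)) (hA : A.Finite) :
    IsSpectral (Measure.count : Measure (Fin d → ℤ)) A ↔
      IsSpectral (volume : Measure (Fin d → ℝ)) (latticeToReal d A + unitCube d) := by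
  lift A to Finset (Fin d → ℤ) using hA
  rw [latticeToReal_add_unitCube]
  exact ⟨fun ⟨_, hΛ⟩ => ⟨_, hΛ.cubeUnion⟩, isSpectral_count_of_isSpectral_cubeUnion⟩
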